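/- Let $G$ be a totally disconnected, locally compact group. For a compact open subgroup $V\leqslant G$ and $x\in G$ put $s_V(x) := [xVx^{-1} : xVx^{-1}\cap V]\in\mathbb{Z}^+$, and let the scale of $x$ be $$s(x) := \min\{\, s_W(x) : W\leqslant G \text{ compact and open}\,\}.$$ A compact open subgroup $V$ is called minimizing for $x$ if this minimum is attained at $V$. A semigroup $S\subseteq G$ (a subset closed under multiplication) is called multiplicative over a compact open subgroup $V$ if $V\subseteq S$ and $s_V(xy)=s_V(x)s_V(y)$ for all $x,y\in S$. Proposition. Let $V$ be a compact open subgroup of $G$ and let the semigroup $S\subseteq G$ be multiplicative over $V$. Then, for every $x\in S$, $V$ is minimizing for $x$ and $s(x)=s_V(x)$. -/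

import Mathlib

namespace TDLC

variable {G : Type*} [Group G]

/-- The conjugate subgroup `x V x⁻¹`. -/
def conjSubgroup (V : Subgroup G) (x : G) : Subgroup G :=
  V.map (MulAut.conj x).toMonoidHom

/-- The index `s_V(x) = [x V x⁻¹ : x V x⁻¹ ∩ V]`. It is a positive integer when `V` is compact
and open, see `localScale_pos`. -/
noncomputable def localScale (V : Subgroup G) (x : G) : ℕ :=
  (conjSubgroup V x ⊓ V).relIndex (conjSubgroup V x)

/-- The index `s_V(x)` is positive (in particular, it is the true index, not the default value
`0` given to infinite indices) whenever `V` is compact and open. -/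
theorem localScale_pos [TopologicalSpace G] [IsTopologicalGroup G] {V : Subgroup G}
    (hc : IsCompact (V : Set G)) (ho : IsOpen (V : Set G)) (x : G) : 0 < localScale V x := by
  have hK : IsCompact (conjSubgroup V x : Set G) := by
    have hcont : Continuous fun g : G => x * g * x⁻¹ := by fun_prop
    exact hc.image hcont
  have : CompactSpace (conjSubgroup V x) := isCompact_iff_compactSpace.mp hK
  have hopen : IsOpen (V.subgroupOf (conjSubgroup V x) : Set (conjSubgroup V x)) :=
    ho.preimage continuous_subtype_val
  have : Finite (conjSubgroup V x ⧸ V.subgroupOf (conjSubgroup V x)) :=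
    Subgroup.quotient_finite_of_isOpen _ hopen
  unfold localScale
  rw [Subgroup.inf_relIndex_left]
  exact Nat.card_pos

/-- The scale `s(x) = min {[x V x⁻¹ : x V x⁻¹ ∩ V] : V ≤ G compact and open}`. -/
noncomputable def scale [TopologicalSpace G] (x : G) : ℕ :=
  sInf {n : ℕ | ∃ V : Subgroup G,
    IsCompact (V : Set G) ∧ IsOpen (V : Set G) ∧ localScale V x = n}

/-- `V` is minimizing for `x` if `V` is a compact open subgroup at which the minimum of
`[x W x⁻¹ : x W x⁻¹ ∩ W]` over all compact open subgroups `W` is attained. -/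
def IsMinimizing [TopologicalSpace G] (V : Subgroup G) (x : G) : Prop :=
  IsCompact (V : Set G) ∧ IsOpen (V : Set G) ∧
    ∀ W : Subgroup G, IsCompact (W : Set G) → IsOpen (W : Set G) →
      localScale V x ≤ localScale W x

/-- The semigroup `S ⊆ G` is multiplicative over `V` if `V ⊆ S` and
`s_V(x y) = s_V(x) s_V(y)` for all `x, y ∈ S`. -/
def IsMultiplicativeOver (S : Subsemigroup G) (V : Subgroup G) : Prop :=
  (V : Set G) ⊆ S ∧
    ∀ x ∈ S, ∀ y ∈ S, localScale V (x * y) = localScale V x * localScale V y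

end TDLC

/-! For compact open `V`, `W`, the functions `s_V` and `s_W` differ by at most a constant factor `C`
independent of the group element. Multiplicativity on `S` and submultiplicativity of `s_W` give
`s_V(x)^n = s_V(x^n) ≤ C s_W(x^n) ≤ C s_W(x)^n` for all `n ≥ 1`, and letting `n` grow removes `C`.
Both bounds on the indices come from `relIndex_le_relIndex_mul_relIndex`. -/

namespace Subgroup

variable {G : Type*} [Group G]

/-- The relative index satisfies a multiplicative triangle inequality. -/
theorem relIndex_le_relIndex_mul_relIndex {A B C : Subgroup G} (hAB : B.relIndex A ≠ 0)
    (hBC : C.relIndex B ≠ 0) : C.relIndex A ≤ C.relIndex B * B.relIndex A := by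
  -- Infinite indices have value `0`, so monotonicity of `relIndex` requires the larger index to be
  -- nonzero.
  have h0 : C.relIndex (B ⊓ A) ≠ 0 := mt (relIndex_eq_zero_of_le_right inf_le_left) hBC
  calc C.relIndex A ≤ (C ⊓ B).relIndex A := by
        refine relIndex_le_of_le_left inf_le_left ?_
        rw [← relIndex_inf_mul_relIndex]
        exact mul_ne_zero h0 hAB
    _ = C.relIndex (B ⊓ A) * B.relIndex A := (relIndex_inf_mul_relIndex C B A).symm
    _ ≤ C.relIndex B * B.relIndex A :=
        Nat.mul_le_mul_right _ (relIndex_le_of_le_right inf_le_left hBC)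

/-- An open subgroup has finite relative index in a compact subgroup. -/
theorem relIndex_ne_zero_of_isOpen_of_isCompact [TopologicalSpace G] [IsTopologicalGroup G]
    {H K : Subgroup G} (hH : IsOpen (H : Set G)) (hK : IsCompact (K : Set G)) :
    H.relIndex K ≠ 0 := by
  have : CompactSpace K := isCompact_iff_compactSpace.mp hK
  have hopen : IsOpen (H.subgroupOf K : Set K) := hH.preimage continuous_subtype_val
  have : Finite (K ⧸ H.subgroupOf K) := quotient_finite_of_isOpen _ hopen
  exact Nat.card_pos.ne'

end Subgroup

/-- If `a ^ n` is bounded by a constant multiple of `b ^ n` for all positive `n`, then `a ≤ b`. -/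
theorem Nat.le_of_forall_pow_le_mul_pow {a b C : ℕ} (hb : 0 < b)
    (h : ∀ n, 0 < n → a ^ n ≤ C * b ^ n) : a ≤ b := by
  by_contra! hab
  have hb' : (0 : ℝ) < b := by exact_mod_cast hb
  have h1 : (1 : ℝ) < a / b := by
    rw [one_lt_div hb']
    exact_mod_cast hab
  obtain ⟨n, hn⟩ := pow_unbounded_of_one_lt (C : ℝ) h1
  -- The exponent is raised by one because `h` covers positive exponents only.
  have hn' : (C : ℝ) < (a / b : ℝ) ^ (n + 1) :=
    hn.trans_le (pow_le_pow_right₀ h1.le n.le_succ)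
  rw [div_pow, lt_div_iff₀ (pow_pos hb' _)] at hn'
  exact (h (n + 1) n.succ_pos).not_gt (by exact_mod_cast hn')

namespace TDLC

variable {G : Type*} [Group G]

theorem localScale_eq_relIndex (V : Subgroup G) (x : G) :
    localScale V x = V.relIndex (conjSubgroup V x) :=
  Subgroup.inf_relIndex_left _ _

theorem conjSubgroup_mul (V : Subgroup G) (x y : G) :
    conjSubgroup V (x * y) = conjSubgroup (conjSubgroup V y) x := by
  simp only [conjSubgroup, Subgroup.map_map, map_mul]
  rfl

theorem relIndex_conjSubgroup (V W : Subgroup G) (x : G) :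
    (conjSubgroup V x).relIndex (conjSubgroup W x) = V.relIndex W :=
  Subgroup.relIndex_map_map_of_injective V W (MulAut.conj x).injective

variable [TopologicalSpace G] [IsTopologicalGroup G] {V W : Subgroup G}

/-- The index `s_V` is submultiplicative. -/
theorem localScale_mul_le (hc : IsCompact (V : Set G)) (ho : IsOpen (V : Set G)) (x y : G) :
    localScale V (x * y) ≤ localScale V x * localScale V y := by
  have hx := (localScale_pos hc ho x).ne'
  have hy := (localScale_pos hc ho y).ne'
  rw [localScale_eq_relIndex] at hx hy
  rw [← relIndex_conjSubgroup _ _ x, ← conjSubgroup_mul] at hy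
  -- Triangle inequality from `(xy)V(xy)⁻¹` to `V` through `xVx⁻¹`; conjugation by `x` preserves
  -- indices.
  have h := Subgroup.relIndex_le_relIndex_mul_relIndex hy hx
  rwa [conjSubgroup_mul, relIndex_conjSubgroup, ← conjSubgroup_mul, ← localScale_eq_relIndex,
    ← localScale_eq_relIndex, ← localScale_eq_relIndex] at h

theorem localScale_pow_le (hc : IsCompact (V : Set G)) (ho : IsOpen (V : Set G)) (x : G)
    {n : ℕ} (hn : 0 < n) : localScale V (x ^ n) ≤ localScale V x ^ n := by
  induction n, hn using Nat.le_induction with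
  | base => simp
  | succ n _ ih =>
    rw [pow_succ, pow_succ]
    exact (localScale_mul_le hc ho _ _).trans (Nat.mul_le_mul_right _ ih)

/-- Changing the compact open subgroup changes `s_V` by a factor bounded independently of the
group element. -/
theorem localScale_le_mul_localScale (hVc : IsCompact (V : Set G)) (hVo : IsOpen (V : Set G))
    (hWc : IsCompact (W : Set G)) (hWo : IsOpen (W : Set G)) (x : G) :
    localScale V x ≤ V.relIndex W * W.relIndex V * localScale W x := by
  have hVW := Subgroup.relIndex_ne_zero_of_isOpen_of_isCompact hVo hWc
  have hWV := Subgroup.relIndex_ne_zero_of_isOpen_of_isCompact hWo hVc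
  have hW := (localScale_pos hWc hWo x).ne'
  rw [localScale_eq_relIndex] at hW
  -- The path is `xVx⁻¹`, `xWx⁻¹`, `W`, `V`: its outer steps cost `W.relIndex V` and `V.relIndex W`,
  -- whatever `x` is.
  have h1 := Subgroup.relIndex_le_relIndex_mul_relIndex hW hVW
  rw [← relIndex_conjSubgroup _ _ x] at hWV
  have h2 := Subgroup.relIndex_le_relIndex_mul_relIndex hWV
    (Subgroup.relIndex_ne_zero_trans hVW hW)
  rw [relIndex_conjSubgroup] at h2
  rw [localScale_eq_relIndex, localScale_eq_relIndex]
  calc _ ≤ _ := h2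
    _ ≤ _ := Nat.mul_le_mul_right _ h1
    _ = _ := by ring

omit [IsTopologicalGroup G] in
theorem IsMinimizing.scale_eq {x : G} (h : IsMinimizing V x) : scale x = localScale V x :=
  IsLeast.csInf_eq ⟨⟨V, h.1, h.2.1, rfl⟩, by rintro _ ⟨W, hc, ho, rfl⟩; exact h.2.2 W hc ho⟩

omit [TopologicalSpace G] [IsTopologicalGroup G] in
theorem IsMultiplicativeOver.localScale_pow {S : Subsemigroup G} (hS : IsMultiplicativeOver S V)
    {x : G} (hx : x ∈ S) {n : ℕ} (hn : 0 < n) :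
    x ^ n ∈ S ∧ localScale V (x ^ n) = localScale V x ^ n := by
  induction n, hn using Nat.le_induction with
  | base => simpa using hx
  | succ n _ ih =>
    rw [pow_succ, pow_succ, hS.2 _ ih.1 _ hx, ih.2]
    exact ⟨S.mul_mem ih.1 hx, rfl⟩

theorem IsMultiplicativeOver.isMinimizing {S : Subsemigroup G} (hS : IsMultiplicativeOver S V)
    (hVc : IsCompact (V : Set G)) (hVo : IsOpen (V : Set G)) {x : G} (hx : x ∈ S) :
    IsMinimizing V x := by
  refine ⟨hVc, hVo, fun W hWc hWo => ?_⟩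
  refine Nat.le_of_forall_pow_le_mul_pow (C := V.relIndex W * W.relIndex V)
    (localScale_pos hWc hWo x) fun n hn => ?_
  rw [← (hS.localScale_pow hx hn).2]
  exact (localScale_le_mul_localScale hVc hVo hWc hWo _).trans
    (Nat.mul_le_mul_left _ (localScale_pow_le hWc hWo x hn))

end TDLC

theorem mainTheorem6 {G : Type*} [Group G] [TopologicalSpace G] [IsTopologicalGroup G]
    [LocallyCompactSpace G] [TotallyDisconnectedSpace G]
    (V : Subgroup G) (hVc : IsCompact (V : Set G)) (hVo : IsOpen (V : Set G))
    (S : Subsemigroup G) (hS : TDLC.IsMultiplicativeOver S V) :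
    ∀ x ∈ S, TDLC.IsMinimizing V x ∧ TDLC.scale x = TDLC.localScale V x := by
  intro x hx
  have h := hS.isMinimizing hVc hVo hx
  exact ⟨h, h.scale_eq⟩
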